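/- **Setting.** Let $\mathcal T$ be a finite scenario tree with node set $\mathcal N$, root $r$, parent map $a(\cdot)$, child sets $\mathcal C(n)$, node probabilities $p_n>0$ with $p_r=1$ and $\sum_{m\in\mathcal C(n)}p_m=p_n$ at non-leaf nodes $n$ (those with $\mathcal C(n)\neq\varnothing$), and transition probabilities $p_{nm}=p_m/p_n$ for $m\in\mathcal C(n)$. At each node $n$ let $\mathcal F_n$ be a compact set of pairs $(x_n,y_n)$ of finite-dimensional variables, $x_n\in\mathbb R^{d_n}$ (with a norm $\|\cdot\|$ and its dual norm $\|\cdot\|_*$), and let $\mathcal X_n$ be the projection of $\mathcal F_n$ to $x_n$; put $x_{a(r)}=0$, $\mathcal X_{a(r)}=\{0\}$. Let $f_n(z,y,x)\in[0,+\infty]$ be lower semicontinuous on $\{z\in\mathcal X_{a(n)},(x,y)\in\mathcal F_n\}$, and suppose some $(x_n,y_n)_n\in\prod_n\mathcal F_n$ has $\sum_n p_nf_n(x_{a(n)},y_n,x_n)<\infty$. For $n\ne r$ let $\sigma_n>0$, let $\psi_n\ge 0$ be a penalty function ($\psi_n(v)=0$ iff $v=0$, and $\operatorname{diam}\{\psi_n\le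 a\}\to0$ as $a\downarrow0$) that is $1$-Lipschitz on $\mathcal X_{a(n)}-\mathcal X_{a(n)}$, and let $l_{n,\lambda},l_{n,\rho}\ge0$, $\mathcal U_n=\{(\lambda,\rho):\|\lambda\|_*\le l_{n,\lambda},\ 0\le\rho\le l_{n,\rho}\}$. Call the problem convex if all $\mathcal F_n$, all $f_n$ (jointly), and all $\psi_n$ (on $\mathcal X_{a(n)}-\mathcal X_{a(n)}$) are convex. Assume that either the problem is convex and, for all $n\neq r$, $\psi_n=\|\cdot\|$, $l_{n,\lambda}\ge\sigma_n$ and $l_{n,\rho}=0$; or $l_{n,\rho}\ge\sigma_n$ for all $n\ne r$. **Oracles.** For a lower semicontinuous $\Theta$ and a parent state $a\in\mathcal X_{a(n)}$: $\mathscr O_r(\Theta)$ returns a minimizer $(x,y)\in\mathcal F_r$ of $f_r(0,y,x)+\Theta(x)$; for $n\ne r$, $\mathscr O^{\rm F}_n(a,\Theta)$ returns a minimizer $(x,y,z)$ of $f_n(z,y,x)+\sigma_n\psi_n(a-z)+\Theta(x)$ over $(x,y)\in\mathcal F_n$, $z\in\mathcal X_{a(n)}$; and $\mathscr O^{\rm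 B}_n(a,\Theta)$ returns an optimal solution $(\hat x,\hat y,\hat z;\hat\lambda,\hat\rho)$ of $\max_{(\lambda,\rho)\in\mathcal U_n}\min_{(x,y)\in\mathcal F_n,\,z\in\mathcal X_{a(n)}}\{f_n(z,y,x)+\langle\lambda,a-z\rangle+\rho\psi_n(a-z)+\Theta(x)\}$. **Algorithm (nested decomposition).** Set $\underline{\mathcal Q}{}_n^0\equiv0$; $\overline{\mathcal Q}{}_n^0\equiv+\infty$ for non-leaf $n$, and $\overline{\mathcal Q}{}_n^j\equiv0$ for all $j$ for leaves; $(x_r^1,y_r^1)=\mathscr O_r(0)$, $LB=f_r(0,y_r^1,x_r^1)$, $UB=+\infty$. While $UB-LB>\epsilon$, iteration $j=1,2,\dots$ does the following. *Forward step*, from the root down: $(x_n^j,y_n^j,z_n^j)=\mathscr O^{\rm F}_n(x_{a(n)}^j,\underline{\mathcal Q}{}_n^{j-1})$ for all $n\ne r$. *Backward step*, from the leaves up to the root: $$\underline{\mathcal Q}{}_n^j(x)=\max\Big\{\underline{\mathcal Q}{}_n^{j-1}(x),\ \sum_{m\in\mathcal C(n)}p_{nm}\big(\underline v{}_m^j-\langle\hat\lambda_m^j,x_n^j-x\rangle-\hat\rho_m^j\psi_m(x_n^j-x)\big)\Big\},$$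 and, for non-leaf $n$, $\overline{\mathcal Q}{}_n^j=\operatorname{op}\{\overline{\mathcal Q}{}_n^{j-1},\ \sum_{m\in\mathcal C(n)}p_{nm}(\bar v_m^j+\sigma_m\|\cdot-x_n^j\|)\}$, where $\operatorname{op}\{g,h\}=\min\{g,h\}$ if the problem is not convex and $\operatorname{op}\{g,h\}(x)=(\min\{g,h\})^{**}(x)=\sup_\lambda\inf_z\{\min\{g(z),h(z)\}+\langle\lambda,x-z\rangle\}$ if it is; here, for $m\neq r$ with parent $n$, $(\hat x_m^j,\hat y_m^j,\hat z_m^j;\hat\lambda_m^j,\hat\rho_m^j)=\mathscr O^{\rm B}_m(x_n^j,\underline{\mathcal Q}{}_m^j)$, $\underline v{}_m^j=f_m(\hat z_m^j,\hat y_m^j,\hat x_m^j)+\langle\hat\lambda_m^j,x_n^j-\hat z_m^j\rangle+\hat\rho_m^j\psi_m(x_n^j-\hat z_m^j)+\underline{\mathcal Q}{}_m^j(\hat x_m^j)$ and $\bar v_m^j=f_m(z_m^j,y_m^j,x_m^j)+\sigma_m\psi_m(x_n^j-z_m^j)+\overline{\mathcal Q}{}_m^j(x_m^j)$. *Root update*: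 $(x_r^{j+1},y_r^{j+1})=\mathscr O_r(\underline{\mathcal Q}{}_r^j)$, $LB=f_r(0,y_r^{j+1},x_r^{j+1})+\underline{\mathcal Q}{}_r^j(x_r^{j+1})$, and if $f_r(0,y_r^{j+1},x_r^{j+1})+\overline{\mathcal Q}{}_r^j(x_r^{j+1})<UB$, then $UB$ is set to this value and $(x_r^*,y_r^*)$ to $(x_r^{j+1},y_r^{j+1})$. **Theorem.** Let $\epsilon>0$, choose $\delta_n>0$ for the non-leaf nodes with $\sum_{n:\mathcal C(n)\ne\varnothing}p_n\delta_n=\epsilon$, and let $\mathcal B_{n,k}\subset\mathbb R^{d_n}$ ($n\in\mathcal N$, $1\le k\le K_n$) be norm balls of diameters $D_{n,k}\ge0$ (closed balls of radius $D_{n,k}/2$) with $\mathcal X_n\subseteq\bigcup_{k}\mathcal B_{n,k}$. Put $L_n=\sum_{m\in\mathcal C(n)}p_{nm}(l_{m,\lambda}+l_{m,\rho})$. If the algorithm terminates, with its root node solution $(x_r^*,y_r^*)$, at the end of the $i$-th iteration (i.e. the test $UB-LB>\epsilon$ holds before each of the iterations $1,\dots,i$ and fails after iteration $i$), then $$i\le\sum_{n\in\mathcal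 N,\ \mathcal C(n)\ne\varnothing}\ \sum_{k=1}^{K_n}\Big(1+\frac{2L_nD_{n,k}}{\delta_n}\Big)^{d_n}.$$ -/

import Mathlib

open Set Filter Topology
open scoped ENNReal Pointwise

namespace NestedDecomp

/-- A finite scenario tree with node set `N`: a root, the parent `a(n)` of every non-root node (the
value of `parent` at the root is a dummy), stages, and the probability of realizing each node. -/
structure ScenarioTree (N : Type*) [Fintype N] [DecidableEq N] where
  root : N
  parent : N → N
  stage : N → ℕ
  stage_root : stage root = 0
  stage_parent : ∀ m, m ≠ root → stage m = stage (parent m) + 1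
  prob : N → ℝ
  prob_pos : ∀ n, 0 < prob n
  prob_root : prob root = 1
  prob_children : ∀ n, (∃ m, m ≠ root ∧ parent m = n) →
    ∑ m with m ≠ root ∧ parent m = n, prob m = prob n

namespace ScenarioTree

variable {N : Type*} [Fintype N] [DecidableEq N] (T : ScenarioTree N)

/-- The set `C(n)` of child nodes of `n`. -/
def children (n : N) : Finset N := {m | m ≠ T.root ∧ T.parent m = n}

/-- The non-leaf nodes, i.e. the nodes with `C(n) ≠ ∅`. -/
def nonLeaves : Finset N := {n | (T.children n).Nonempty}

/-- Transition probability `p_{nm} = p_m / p_n`. -/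
noncomputable def trans (n m : N) : ℝ := T.prob m / T.prob n

end ScenarioTree

/-- Data of a multistage problem on the tree `T`, together with the penalty data and the bounds on
the dual variables. The state variable of node `n` lives in `E n`, the internal variable in `Y n`.

Objects of a non-root node `m` that involve the state of its parent `n = a(m)` are indexed by the
pair `n m`; they are used only when `m` is a child of `n`. The root has the dummy parent state `0`,
so its cost `fRoot y x` is `f_r(0, y, x)`. -/
structure Problem {N : Type*} [Fintype N] [DecidableEq N] (T : ScenarioTree N)
    (E Y : N → Type*) where
  /-- feasibility set of `(x_n, y_n)` -/
  F : ∀ n, Set (E n × Y n)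
  /-- cost of the root, `fRoot y x` -/
  fRoot : Y T.root → E T.root → ℝ≥0∞
  /-- cost of node `m` with parent `n`, `f n m z y x` with `z` the (copy of the) parent state -/
  f : ∀ n m, E n → Y m → E m → ℝ≥0∞
  /-- penalty function of node `m` with parent `n` -/
  ψ : ∀ n : N, N → E n → ℝ
  /-- penalty parameters -/
  σ : N → ℝ
  /-- bound on the dual norm of the multiplier `λ` -/
  lLam : N → ℝ
  /-- bound on the multiplier `ρ` -/
  lRho : N → ℝ

/-- A penalty function: nonnegative, vanishing exactly at `0`, with the diameter of the level set
`{ψ ≤ a}` tending to `0` as `a → 0`. -/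
structure IsPenaltyFunction {V : Type*} [NormedAddCommGroup V] (ψ : V → ℝ) : Prop where
  nonneg : ∀ v, 0 ≤ ψ v
  eq_zero_iff : ∀ v, ψ v = 0 ↔ v = 0
  diam_tendsto : Tendsto (fun a : ℝ => Metric.ediam {v | ψ v ≤ a}) (𝓝[>] 0) (𝓝 0)

/-- `conv{f, g} = (min{f, g})**`, written out by convex conjugacy. -/
noncomputable def convMin {V : Type*} [NormedAddCommGroup V] [NormedSpace ℝ V]
    (f g : V → EReal) (x : V) : EReal :=
  ⨆ l : StrongDual ℝ V, ⨅ z : V, (min (f z) (g z) + ((l (x - z) : ℝ) : EReal))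

/-- Joint convexity on `s` of a function with values in `[0, +∞]`. -/
def ENNConvexOn {V : Type*} [AddCommGroup V] [Module ℝ V] (s : Set V) (g : V → ℝ≥0∞) : Prop :=
  Convex ℝ s ∧ ∀ v ∈ s, ∀ w ∈ s, ∀ a b : ℝ, 0 ≤ a → 0 ≤ b → a + b = 1 →
    g (a • v + b • w) ≤ ENNReal.ofReal a * g v + ENNReal.ofReal b * g w

namespace Problem

variable {N : Type*} [Fintype N] [DecidableEq N] {T : ScenarioTree N} {E Y : N → Type*}

/-- State space of node `n`: the projection of the feasibility set. -/
def X (P : Problem T E Y) (n : N) : Set (E n) := Prod.fst '' P.F n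

/-- The constraints `(x, y) ∈ F_m`, `z ∈ X_n` of the nodal problem of node `m` with parent `n`;
points are triples `(x, y, z)`. -/
def feasible (P : Problem T E Y) (n m : N) : Set (E m × Y m × E n) :=
  {w | (w.1, w.2.1) ∈ P.F m ∧ w.2.2 ∈ P.X n}

/-- Objective of the extensive form, `∑ p_n f_n(x_{a(n)}, y_n, x_n)`. -/
noncomputable def totalCost (P : Problem T E Y) (x : ∀ n, E n) (y : ∀ n, Y n) : ℝ≥0∞ :=
  ENNReal.ofReal (T.prob T.root) * P.fRoot (y T.root) (x T.root) +
    ∑ n, ∑ m ∈ T.children n, ENNReal.ofReal (T.prob m) * P.f n m (x n) (y m) (x m)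

/-- `L_n = ∑_{m ∈ C(n)} p_{nm} (l_{m,λ} + l_{m,ρ})`. -/
noncomputable def L (P : Problem T E Y) (n : N) : ℝ :=
  ∑ m ∈ T.children n, T.trans n m * (P.lLam m + P.lRho m)

variable [∀ n, NormedAddCommGroup (E n)] [∀ n, NormedAddCommGroup (Y n)]

/-- Compact feasibility sets, lower semicontinuous costs (on their domains), and a feasible point of
finite total cost. -/
structure MinCondition (P : Problem T E Y) : Prop where
  compact : ∀ n, IsCompact (P.F n)
  lsc_root : LowerSemicontinuousOn (fun w : E T.root × Y T.root => P.fRoot w.2 w.1) (P.F T.root)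
  lsc : ∀ n, ∀ m ∈ T.children n,
    LowerSemicontinuousOn (fun w : E m × Y m × E n => P.f n m w.2.2 w.2.1 w.1) (P.feasible n m)
  proper : ∃ (x : ∀ n, E n) (y : ∀ n, Y n), (∀ n, (x n, y n) ∈ P.F n) ∧ P.totalCost x y < ⊤

variable [∀ n, NormedSpace ℝ (E n)] [∀ n, NormedSpace ℝ (Y n)]

/-- The (regularized) problem is convex: convex feasibility sets, jointly convex costs, convex
penalties. -/
structure IsConvex (P : Problem T E Y) : Prop where
  convex_F : ∀ n, Convex ℝ (P.F n)
  convex_root : ENNConvexOn (P.F T.root) (fun w : E T.root × Y T.root => P.fRoot w.2 w.1)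
  convex_f : ∀ n, ∀ m ∈ T.children n,
    ENNConvexOn (P.feasible n m) (fun w : E m × Y m × E n => P.f n m w.2.2 w.2.1 w.1)
  convex_ψ : ∀ n, ∀ m ∈ T.children n, ConvexOn ℝ (P.X n - P.X n) (P.ψ n m)

/-- Standing conditions on the penalties and on the bounds of the dual variables: the penalty
functions are scaled to be `1`-Lipschitz on `X_{a(m)} - X_{a(m)}`; either the problem is convex with
all penalties equal to the norm, `l_{m,λ} ≥ σ_m` and `l_{m,ρ} = 0`, or `l_{m,ρ} ≥ σ_m`. -/
structure PenaltyCondition (P : Problem T E Y) : Prop where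
  penalty : ∀ n, ∀ m ∈ T.children n, IsPenaltyFunction (P.ψ n m)
  lipschitz : ∀ n, ∀ m ∈ T.children n, LipschitzOnWith 1 (P.ψ n m) (P.X n - P.X n)
  σ_pos : ∀ m, m ≠ T.root → 0 < P.σ m
  lLam_nonneg : ∀ m, m ≠ T.root → 0 ≤ P.lLam m
  lRho_nonneg : ∀ m, m ≠ T.root → 0 ≤ P.lRho m
  bounds :
    (P.IsConvex ∧ ∀ n, ∀ m ∈ T.children n,
      (∀ v, P.ψ n m v = ‖v‖) ∧ P.σ m ≤ P.lLam m ∧ P.lRho m = 0) ∨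
    (∀ m, m ≠ T.root → P.σ m ≤ P.lRho m)

/-- Objective of the forward step problem of node `m`, at the parent state `a` and with the
approximation `Θ` of the cost-to-go function; `w = (x, y, z)`. -/
noncomputable def forwardObj (P : Problem T E Y) (n m : N) (a : E n) (Θ : E m → ℝ)
    (w : E m × Y m × E n) : EReal :=
  (P.f n m w.2.2 w.2.1 w.1 : EReal) + ((P.σ m * P.ψ n m (a - w.2.2) + Θ w.1 : ℝ) : EReal)

/-- Objective of the inner minimization in the backward step problem of node `m`, with the dual
variables `u = (λ, ρ)`. -/
noncomputable def backwardObj (P : Problem T E Y) (n m : N) (a : E n) (Θ : E m → ℝ)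
    (u : StrongDual ℝ (E n) × ℝ) (w : E m × Y m × E n) : EReal :=
  (P.f n m w.2.2 w.2.1 w.1 : EReal) +
    ((u.1 (a - w.2.2) + u.2 * P.ψ n m (a - w.2.2) + Θ w.1 : ℝ) : EReal)

/-- Objective of the root problem. -/
noncomputable def rootObj (P : Problem T E Y) (Θ : E T.root → ℝ) (w : E T.root × Y T.root) :
    EReal :=
  (P.fRoot w.2 w.1 : EReal) + ((Θ w.1 : ℝ) : EReal)

/-- The set `U_m` of dual variables; the norm of the strong dual is the dual norm. -/
def dualSet (P : Problem T E Y) (n m : N) : Set (StrongDual ℝ (E n) × ℝ) :=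
  {u | ‖u.1‖ ≤ P.lLam m ∧ 0 ≤ u.2 ∧ u.2 ≤ P.lRho m}

/-- `w` is an optimal solution of the forward step problem. -/
def IsForwardSol (P : Problem T E Y) (n m : N) (a : E n) (Θ : E m → ℝ)
    (w : E m × Y m × E n) : Prop :=
  w ∈ P.feasible n m ∧ IsMinOn (P.forwardObj n m a Θ) (P.feasible n m) w

/-- `(x, y, z; λ, ρ)` is an optimal solution of the backward step (max-min) problem: `(λ, ρ)`
maximizes the optimal value of the inner problem, which `(x, y, z)` attains. -/
def IsBackwardSol (P : Problem T E Y) (n m : N) (a : E n) (Θ : E m → ℝ)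
    (s : E m × Y m × E n × StrongDual ℝ (E n) × ℝ) : Prop :=
  s.2.2.2 ∈ P.dualSet n m ∧
  IsMaxOn (fun u => ⨅ w ∈ P.feasible n m, P.backwardObj n m a Θ u w) (P.dualSet n m) s.2.2.2 ∧
  (s.1, s.2.1, s.2.2.1) ∈ P.feasible n m ∧
  IsMinOn (P.backwardObj n m a Θ s.2.2.2) (P.feasible n m) (s.1, s.2.1, s.2.2.1)

/-- `w` is an optimal solution of the root problem. -/
def IsRootSol (P : Problem T E Y) (Θ : E T.root → ℝ) (w : E T.root × Y T.root) : Prop :=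
  w ∈ P.F T.root ∧ IsMinOn (P.rootObj Θ) (P.F T.root) w

/-- Subproblem oracles: mappings that return some optimal solution of the respective subproblem, for
every parent state in the state space and every l.s.c. function `Θ` on the state space. -/
structure Oracles (P : Problem T E Y) where
  root : (E T.root → ℝ) → E T.root × Y T.root
  forward : ∀ n m : N, E n → (E m → ℝ) → E m × Y m × E n
  backward : ∀ n m : N, E n → (E m → ℝ) → E m × Y m × E n × StrongDual ℝ (E n) × ℝ
  root_spec : ∀ Θ, LowerSemicontinuousOn Θ (P.X T.root) → P.IsRootSol Θ (root Θ)
  forward_spec : ∀ n, ∀ m ∈ T.children n, ∀ a ∈ P.X n, ∀ Θ, LowerSemicontinuousOn Θ (P.X m) →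
    P.IsForwardSol n m a Θ (forward n m a Θ)
  backward_spec : ∀ n, ∀ m ∈ T.children n, ∀ a ∈ P.X n, ∀ Θ, LowerSemicontinuousOn Θ (P.X m) →
    P.IsBackwardSol n m a Θ (backward n m a Θ)

/-- The generalized conjugacy cut of node `m` (with parent `n`) generated at the parent state `a`:
`-⟨λ, a - x⟩ - ρ ψ(a - x) + v`. -/
noncomputable def cut (P : Problem T E Y) (n m : N) (a : E n) (l : StrongDual ℝ (E n)) (ρ v : ℝ)
    (x : E n) : ℝ :=
  -l (a - x) - ρ * P.ψ n m (a - x) + v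

end Problem

/-- The quantities computed by the nested decomposition algorithm; the first argument is the
iteration index. -/
structure Iterates {N : Type*} [Fintype N] [DecidableEq N] (T : ScenarioTree N) (E Y : N → Type*)
    [∀ n, NormedAddCommGroup (E n)] [∀ n, NormedSpace ℝ (E n)] where
  /-- forward step (and root) solutions; `z j n m` is the copy of the state of `n = a(m)` -/
  x : ℕ → ∀ n, E n
  y : ℕ → ∀ n, Y n
  z : ℕ → ∀ n : N, N → E n
  /-- backward step solutions -/
  xHat : ℕ → ∀ n, E n
  yHat : ℕ → ∀ n, Y n
  zHat : ℕ → ∀ n : N, N → E n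
  lam : ℕ → ∀ n : N, N → StrongDual ℝ (E n)
  rho : ℕ → N → ℝ
  /-- the values `v̲` and `v̄` -/
  vLow : ℕ → N → ℝ
  vUp : ℕ → N → EReal
  /-- under- and over-approximations of the cost-to-go functions -/
  underQ : ℕ → ∀ n, E n → ℝ
  overQ : ℕ → ∀ n, E n → EReal
  lower : ℕ → EReal
  upper : ℕ → EReal
  /-- incumbent root solution -/
  xStar : ℕ → E T.root
  yStar : ℕ → Y T.root

section Algorithm

variable {N : Type*} [Fintype N] [DecidableEq N] {T : ScenarioTree N} {E Y : N → Type*}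
  [∀ n, NormedAddCommGroup (E n)] [∀ n, NormedAddCommGroup (Y n)]
  [∀ n, NormedSpace ℝ (E n)] [∀ n, NormedSpace ℝ (Y n)]

/-- The candidate upper model `x ↦ ∑_{m ∈ C(n)} p_{nm} (v̄_m + σ_m ‖x - x_n‖)` of iteration `j`. -/
noncomputable def Iterates.upperModel (S : Iterates T E Y) (P : Problem T E Y) (j : ℕ) (n : N)
    (x : E n) : EReal :=
  ∑ m ∈ T.children n,
    ((T.trans n m : ℝ) : EReal) * (S.vUp j m + ((P.σ m * ‖x - S.x j n‖ : ℝ) : EReal))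

/-- The upper bound `f_r(0, y_r^{j+1}, x_r^{j+1}) + overQ_r^j(x_r^{j+1})` given by the root solution
computed at the end of iteration `j`. -/
noncomputable def Iterates.candidate (S : Iterates T E Y) (P : Problem T E Y) (j : ℕ) : EReal :=
  (P.fRoot (S.y (j + 1) T.root) (S.x (j + 1) T.root) : EReal) +
    S.overQ j T.root (S.x (j + 1) T.root)

/-- `S` records an execution of the algorithm with oracles `O` and tolerance `ε` in which (at least)
the iterations `1, …, i` are carried out. Iteration `j + 1` is described for each `j < i`. -/
structure IsExecution (P : Problem T E Y) (O : P.Oracles) (ε : ℝ) (S : Iterates T E Y) (i : ℕ) :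
    Prop where
  /- initialization -/
  under_zero : ∀ n x, S.underQ 0 n x = 0
  over_zero : ∀ n, (T.children n).Nonempty → ∀ x, S.overQ 0 n x = ⊤
  root_init : (S.x 1 T.root, S.y 1 T.root) = O.root (fun _ => 0)
  lower_zero : S.lower 0 = (P.fRoot (S.y 1 T.root) (S.x 1 T.root) : EReal)
  upper_zero : S.upper 0 = ⊤
  /- loop test: iteration `j + 1` is entered -/
  continues : ∀ j < i, (ε : EReal) < S.upper j - S.lower j
  /- forward step -/
  forward : ∀ j < i, ∀ n, ∀ m ∈ T.children n,
    (S.x (j + 1) m, S.y (j + 1) m, S.z (j + 1) n m) =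
      O.forward n m (S.x (j + 1) n) (S.underQ j m)
  /- backward step (and root node update) -/
  under_succ : ∀ j < i, ∀ n x, S.underQ (j + 1) n x =
    max (S.underQ j n x) (∑ m ∈ T.children n, T.trans n m *
      P.cut n m (S.x (j + 1) n) (S.lam (j + 1) n m) (S.rho (j + 1) m) (S.vLow (j + 1) m) x)
  over_leaf : ∀ j ≤ i, ∀ n, T.children n = ∅ → ∀ x, S.overQ j n x = 0
  over_succ_convex : P.IsConvex → ∀ j < i, ∀ n, (T.children n).Nonempty → ∀ x,
    S.overQ (j + 1) n x = convMin (S.overQ j n) (S.upperModel P (j + 1) n) x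
  over_succ_nonconvex : ¬ P.IsConvex → ∀ j < i, ∀ n, (T.children n).Nonempty → ∀ x,
    S.overQ (j + 1) n x = min (S.overQ j n x) (S.upperModel P (j + 1) n x)
  backward : ∀ j < i, ∀ n, ∀ m ∈ T.children n,
    (S.xHat (j + 1) m, S.yHat (j + 1) m, S.zHat (j + 1) n m, S.lam (j + 1) n m, S.rho (j + 1) m) =
      O.backward n m (S.x (j + 1) n) (S.underQ (j + 1) m)
  /- the cost of an optimal backward solution is finite, so `toReal` loses nothing -/
  vLow_eq : ∀ j < i, ∀ n, ∀ m ∈ T.children n, S.vLow (j + 1) m =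
    (P.f n m (S.zHat (j + 1) n m) (S.yHat (j + 1) m) (S.xHat (j + 1) m)).toReal +
      S.lam (j + 1) n m (S.x (j + 1) n - S.zHat (j + 1) n m) +
      S.rho (j + 1) m * P.ψ n m (S.x (j + 1) n - S.zHat (j + 1) n m) +
      S.underQ (j + 1) m (S.xHat (j + 1) m)
  vUp_eq : ∀ j < i, ∀ n, ∀ m ∈ T.children n, S.vUp (j + 1) m =
    (P.f n m (S.z (j + 1) n m) (S.y (j + 1) m) (S.x (j + 1) m) : EReal) +
      ((P.σ m * P.ψ n m (S.x (j + 1) n - S.z (j + 1) n m) : ℝ) : EReal) +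
      S.overQ (j + 1) m (S.x (j + 1) m)
  /- root step and bounds -/
  root_succ : ∀ j < i, (S.x (j + 2) T.root, S.y (j + 2) T.root) =
    O.root (S.underQ (j + 1) T.root)
  lower_succ : ∀ j < i, S.lower (j + 1) =
    (P.fRoot (S.y (j + 2) T.root) (S.x (j + 2) T.root) : EReal) +
      ((S.underQ (j + 1) T.root (S.x (j + 2) T.root) : ℝ) : EReal)
  upper_update : ∀ j < i, S.candidate P (j + 1) < S.upper j →
    S.upper (j + 1) = S.candidate P (j + 1) ∧
      S.xStar (j + 1) = S.x (j + 2) T.root ∧ S.yStar (j + 1) = S.y (j + 2) T.root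
  upper_keep : ∀ j < i, ¬ S.candidate P (j + 1) < S.upper j →
    S.upper (j + 1) = S.upper j ∧ S.xStar (j + 1) = S.xStar j ∧ S.yStar (j + 1) = S.yStar j

/-- The execution stops at the end of iteration `i`: the loop is entered `i` times and the loop test
then fails. -/
def TerminatesAt (P : Problem T E Y) (O : P.Oracles) (ε : ℝ) (S : Iterates T E Y) (i : ℕ) : Prop :=
  IsExecution P O ε S i ∧ ¬ (ε : EReal) < S.upper i - S.lower i

end Algorithm

end NestedDecomp

/-! Each iteration is charged to a non-leaf node and a ball, and each such pair can be charged only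
as often as a packing bound allows. Spread `ε` over the tree by tolerances: `γ = 0` at leaves and `γ
n = δ n + ∑ p_{nm} γ m` elsewhere, so that `γ` at the root is `ε`. As long as the loop runs, the gap
`overQ - underQ` at the root trial state exceeds `ε` (`root_gap`). Hence some deepest node `n` has a
gap above `γ n`, while its children's gaps stay within theirs (`exists_last_gap`). The backward step
then repairs `n`. The max-min dual value is at least the forward value (`forwardObj_le_vLow`), so
`vUp - vLow` at a child is at most that child's gap. The cuts and the upper model have controlled
slopes, so every later gap at `x` is at most `∑ p_{nm} γ m + 2 L_n ‖x - x_n‖` (`over_le_under_add`).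
A later charge to `n` needs a gap above `δ n + ∑ p_{nm} γ m`, so trial states charged to `n` are at
least `δ n / (2 L_n)` apart, and comparing volumes counts them in each ball. Only the two models are
compared with each other; the true cost-to-go functions never enter. -/

namespace NestedDecomp

/-! ### Packing in a finite-dimensional normed space -/

/-- Packing bound: points of a closed ball of radius `R` with pairwise distances at least `s`. -/
theorem card_le_of_separated_of_mem_closedBall {ι V : Type*} [NormedAddCommGroup V]
    [NormedSpace ℝ V] [FiniteDimensional ℝ V] (A : Finset ι) (x : ι → V) (c : V) {R s : ℝ}
    (hR : 0 ≤ R) (hs : 0 < s) (hx : ∀ i ∈ A, x i ∈ Metric.closedBall c R)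
    (hsep : ∀ i ∈ A, ∀ j ∈ A, i ≠ j → s ≤ ‖x i - x j‖) :
    (A.card : ℝ) ≤ (1 + 2 * R / s) ^ Module.finrank ℝ V := by
  borelize V
  let μ : MeasureTheory.Measure V := MeasureTheory.Measure.addHaar
  have hs2 : 0 < s / 2 := by positivity
  have hρ : 0 < R + s / 2 := by positivity
  -- Balls of radius `s / 2` about the points are disjoint and fit into a ball of radius `R + s /
  -- 2`; the ratio of volumes bounds their number.
  have hdisj : Set.Pairwise (A : Set ι) (Function.onFun Disjoint fun i => Metric.ball (x i) (s / 2)) := by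
    intro i hi j hj hij
    apply Metric.ball_disjoint_ball
    rw [dist_eq_norm]
    linarith [hsep i hi j hj hij]
  have hsub : (⋃ i ∈ A, Metric.ball (x i) (s / 2)) ⊆ Metric.ball c (R + s / 2) := by
    refine iUnion₂_subset fun i hi => Metric.ball_subset_ball' ?_
    have := Metric.mem_closedBall.1 (hx i hi)
    linarith
  have hvol : (A.card : ℝ≥0∞) * ENNReal.ofReal ((s / 2) ^ Module.finrank ℝ V) *
      μ (Metric.ball 0 1) ≤
      ENNReal.ofReal ((R + s / 2) ^ Module.finrank ℝ V) * μ (Metric.ball 0 1) := by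
    calc _ = μ (⋃ i ∈ A, Metric.ball (x i) (s / 2)) := by
          rw [MeasureTheory.measure_biUnion_finset hdisj fun _ _ => measurableSet_ball]
          simp only [μ.addHaar_ball_of_pos _ hs2, Finset.sum_const, nsmul_eq_mul, mul_assoc]
      _ ≤ μ (Metric.ball c (R + s / 2)) := MeasureTheory.measure_mono hsub
      _ = _ := by rw [μ.addHaar_ball_of_pos _ hρ]
  have hcard : (A.card : ℝ≥0∞) * ENNReal.ofReal ((s / 2) ^ Module.finrank ℝ V) ≤
      ENNReal.ofReal ((R + s / 2) ^ Module.finrank ℝ V) :=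
    (ENNReal.mul_le_mul_iff_left (Metric.measure_ball_pos _ _ zero_lt_one).ne'
      MeasureTheory.measure_ball_lt_top.ne).1 hvol
  have hreal : (A.card : ℝ) * (s / 2) ^ Module.finrank ℝ V ≤
      (R + s / 2) ^ Module.finrank ℝ V := by
    have := ENNReal.toReal_le_of_le_ofReal (pow_nonneg hρ.le _) hcard
    rwa [ENNReal.toReal_mul, ENNReal.toReal_natCast,
      ENNReal.toReal_ofReal (pow_nonneg hs2.le _)] at this
  have hratio : 1 + 2 * R / s = (R + s / 2) / (s / 2) := by field_simp; ring
  rw [hratio, div_pow, le_div_iff₀ (pow_pos hs2 _)]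
  exact hreal

/-! ### Exact norm penalties by separation -/

/-- A norm penalty `σ ‖a - z w‖` in a convex problem can be replaced by a linear term without
lowering the optimal value. -/
theorem exists_dual_of_norm_penalty {V W : Type*} [NormedAddCommGroup V] [NormedSpace ℝ V]
    [AddCommGroup W] [Module ℝ W] {C : Set W} {g : W → ℝ} (hg : ConvexOn ℝ C g) (z : W →ₗ[ℝ] V)
    (a : V) {σ v₀ : ℝ} (hσ : 0 ≤ σ) (hv : ∀ w ∈ C, v₀ ≤ g w + σ * ‖a - z w‖) :
    ∃ l : StrongDual ℝ V, ‖l‖ ≤ σ ∧ ∀ w ∈ C, v₀ ≤ g w + l (a - z w) := by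
  rcases C.eq_empty_or_nonempty with rfl | ⟨w₀, hw₀⟩
  · exact ⟨0, by simpa using hσ, by simp⟩
  -- Hahn-Banach separates the open strict hypograph `B` of `v₀ - σ ‖·‖` from the epigraph-like set
  -- `A` of pairs (constraint residual, cost); `hv` says exactly that they are disjoint. The slope
  -- of the hyperplane is the multiplier.
  let B : Set (V × ℝ) := {q | q.2 < v₀ - σ * ‖q.1‖}
  let A : Set (V × ℝ) := {q | ∃ w ∈ C, q.1 = a - z w ∧ g w ≤ q.2}
  have hBo : IsOpen B := isOpen_lt (by fun_prop) (by fun_prop)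
  have hB : Convex ℝ B := by
    intro p hp q hq s t hs ht hst
    simp only [B, mem_ofPred_eq, Prod.fst_add, Prod.snd_add, Prod.smul_fst, Prod.smul_snd,
      smul_eq_mul] at hp hq ⊢
    have h1 : ‖s • p.1 + t • q.1‖ ≤ s * ‖p.1‖ + t * ‖q.1‖ := by
      refine (norm_add_le _ _).trans (le_of_eq ?_)
      rw [norm_smul, norm_smul, Real.norm_of_nonneg hs, Real.norm_of_nonneg ht]
    have h2 := mul_le_mul_of_nonneg_left h1 hσ
    have h3 : s * p.2 + t * q.2 < s * (v₀ - σ * ‖p.1‖) + t * (v₀ - σ * ‖q.1‖) := by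
      rcases hs.eq_or_lt with rfl | hs'
      · obtain rfl : t = 1 := by linarith
        linarith
      · have := mul_lt_mul_of_pos_left hp hs'
        have := mul_le_mul_of_nonneg_left hq.le ht
        linarith
    have h4 : s * v₀ + t * v₀ = v₀ := by rw [← add_mul, hst, one_mul]
    linarith
  have hA : Convex ℝ A := by
    rintro p ⟨w, hw, hpw, hgw⟩ q ⟨w', hw', hqw, hgw'⟩ s t hs ht hst
    refine ⟨s • w + t • w', hg.1 hw hw' hs ht hst, ?_, ?_⟩
    · simp only [Prod.fst_add, Prod.smul_fst, hpw, hqw, map_add, map_smul, smul_sub]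
      have : a = s • a + t • a := by rw [← add_smul, hst, one_smul]
      nth_rewrite 3 [this]
      abel
    · refine (hg.2 hw hw' hs ht hst).trans ?_
      simp only [Prod.snd_add, Prod.smul_snd]
      exact add_le_add (mul_le_mul_of_nonneg_left hgw hs) (mul_le_mul_of_nonneg_left hgw' ht)
  have hAB : Disjoint B A := by
    rw [Set.disjoint_left]
    rintro q hq ⟨w, hw, hqw, hgw⟩
    have h1 : q.2 < v₀ - σ * ‖q.1‖ := hq
    rw [hqw] at h1
    linarith [hv w hw]
  obtain ⟨f, u, hfB, hfA⟩ := geometric_hahn_banach_open hB hBo hA hAB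
  let f₁ : StrongDual ℝ V := f.comp (ContinuousLinearMap.inl ℝ V ℝ)
  let τ : ℝ := f (0, 1)
  have hf : ∀ v t, f (v, t) = f₁ v + t * τ := by
    intro v t
    have : ((v, t) : V × ℝ) = (v, 0) + t • (0, 1) := by simp
    rw [this, map_add, map_smul]
    simp [f₁, τ]
  have hlow : ∀ v t, t < v₀ - σ * ‖v‖ → f₁ v + t * τ < u := by
    intro v t ht
    rw [← hf]
    exact hfB (v, t) ht
  have hup : ∀ w ∈ C, u ≤ f₁ (a - z w) + g w * τ := by
    intro w hw
    rw [← hf]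
    exact hfA _ ⟨w, hw, rfl, le_rfl⟩
  -- The hyperplane is not vertical, since `B` has a point strictly below a point of `A` over `a - z
  -- w₀`.
  have hτ : 0 < τ := by
    have h1 := hlow (a - z w₀) (v₀ - σ * ‖a - z w₀‖ - 1) (by linarith)
    have h2 := hup w₀ hw₀
    have h3 := hv w₀ hw₀
    by_contra hτ
    push Not at hτ
    nlinarith
  have hlow' : ∀ v, f₁ v + (v₀ - σ * ‖v‖) * τ ≤ u := by
    intro v
    refine le_of_forall_pos_lt_add fun η hη => ?_
    have h := hlow v (v₀ - σ * ‖v‖ - η / τ) (by linarith [div_pos hη hτ])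
    have : η / τ * τ = η := div_mul_cancel₀ _ hτ.ne'
    nlinarith
  -- A violation at `v` would grow without bound along the multiples `k • v`, against `hlow'`.
  have hbd : ∀ v, f₁ v ≤ σ * τ * ‖v‖ := by
    intro v
    by_contra! hcon
    obtain ⟨k, hk⟩ := exists_nat_gt ((u - v₀ * τ) / (f₁ v - σ * τ * ‖v‖))
    rw [div_lt_iff₀ (by linarith)] at hk
    have h := hlow' ((k : ℝ) • v)
    rw [map_smul, norm_smul, Real.norm_of_nonneg (Nat.cast_nonneg k), smul_eq_mul] at h
    linarith
  refine ⟨τ⁻¹ • f₁, ?_, ?_⟩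
  · refine ContinuousLinearMap.opNorm_le_bound _ hσ fun v => ?_
    have h1 := hbd v
    have h2 := hbd (-v)
    rw [map_neg, norm_neg] at h2
    have h3 : |f₁ v| ≤ σ * τ * ‖v‖ := abs_le.2 ⟨by linarith, h1⟩
    rw [smul_apply, norm_smul, Real.norm_of_nonneg (inv_pos.2 hτ).le,
      Real.norm_eq_abs, inv_mul_le_iff₀ hτ]
    linarith
  · intro w hw
    have h1 := hup w hw
    have h2 := hlow' 0
    simp only [map_zero, norm_zero, mul_zero, sub_zero, zero_add] at h2
    rw [smul_apply, smul_eq_mul]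
    have h3 : v₀ * τ ≤ (g w + τ⁻¹ * f₁ (a - z w)) * τ := by
      rw [add_mul, mul_right_comm, inv_mul_cancel₀ hτ.ne', one_mul]
      linarith
    exact le_of_mul_le_mul_right h3 hτ

/-! ### Sums over the scenario tree -/

namespace ScenarioTree

variable {N : Type*} [Fintype N] [DecidableEq N] (T : ScenarioTree N)

theorem mem_children {n m : N} : m ∈ T.children n ↔ m ≠ T.root ∧ T.parent m = n := by
  simp [children]

theorem stage_of_mem_children {n m : N} (h : m ∈ T.children n) : T.stage m = T.stage n + 1 := by
  obtain ⟨h1, rfl⟩ := T.mem_children.1 h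
  exact T.stage_parent m h1

/-- The sum of `b` over the subtree rooted at `n`. -/
noncomputable def subtreeSum (b : N → ℝ) (n : N) : ℝ :=
  b n + ∑ m ∈ (T.children n).attach, subtreeSum b m.1
termination_by Finset.univ.sup T.stage - T.stage n
decreasing_by
  have h1 := T.stage_of_mem_children m.2
  have h2 := Finset.le_sup (f := T.stage) (Finset.mem_univ m.1)
  omega

theorem subtreeSum_eq (b : N → ℝ) (n : N) :
    T.subtreeSum b n = b n + ∑ m ∈ T.children n, T.subtreeSum b m := by
  rw [subtreeSum, Finset.sum_attach (T.children n) (T.subtreeSum b)]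

theorem sum_sum_children (g : N → ℝ) :
    ∑ n, ∑ m ∈ T.children n, g m = ∑ m with m ≠ T.root, g m := by
  rw [← Finset.sum_fiberwise (Finset.univ.filter fun m => m ≠ T.root) T.parent g]
  simp only [children, Finset.filter_filter]

/-- Summing the recursion over all nodes counts every non-root node exactly once as a child, so all
subtree sums but that of the root cancel. -/
theorem subtreeSum_root (b : N → ℝ) : T.subtreeSum b T.root = ∑ n, b n := by
  have h1 : ∑ n, T.subtreeSum b n = ∑ n, b n + ∑ m with m ≠ T.root, T.subtreeSum b m := by
    rw [← sum_sum_children, ← Finset.sum_add_distrib]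
    exact Finset.sum_congr rfl fun n _ => T.subtreeSum_eq b n
  have h2 := Finset.sum_filter_add_sum_filter_not Finset.univ (fun m => m ≠ T.root)
    (T.subtreeSum b)
  have h3 : ∑ m with ¬ m ≠ T.root, T.subtreeSum b m = T.subtreeSum b T.root := by
    simp [Finset.sum_filter]
  linarith

theorem trans_pos (n m : N) : 0 < T.trans n m := div_pos (T.prob_pos m) (T.prob_pos n)

end ScenarioTree

end NestedDecomp

namespace NestedDecomp

/-- Test the infimum at `z = x`. This is the only property of the convexified minimum that is
needed, so the convex and nonconvex updates can be treated alike. -/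
theorem convMin_le_min {V : Type*} [NormedAddCommGroup V] [NormedSpace ℝ V] (f g : V → EReal)
    (x : V) : convMin f g x ≤ min (f x) (g x) := by
  refine iSup_le fun l => (iInf_le _ x).trans ?_
  simp

theorem ereal_coe_sum {ι : Type*} (A : Finset ι) (g : ι → ℝ) :
    ((∑ a ∈ A, g a : ℝ) : EReal) = ∑ a ∈ A, (g a : EReal) :=
  map_sum (⟨⟨Real.toEReal, EReal.coe_zero⟩, EReal.coe_add⟩ : ℝ →+ EReal) g A

variable {N : Type*} [Fintype N] [DecidableEq N] {T : ScenarioTree N} {E Y : N → Type*}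
  [∀ n, NormedAddCommGroup (E n)] [∀ n, NormedAddCommGroup (Y n)]

/-! ### Nodal subproblems, cuts and duality -/

namespace Problem

variable {P : Problem T E Y}

theorem MinCondition.exists_finite (hP : P.MinCondition) :
    ∃ (x : ∀ n, E n) (y : ∀ n, Y n), (∀ n, (x n, y n) ∈ P.F n) ∧
      P.fRoot (y T.root) (x T.root) ≠ ⊤ ∧
      ∀ n, ∀ m ∈ T.children n, P.f n m (x n) (y m) (x m) ≠ ⊤ := by
  obtain ⟨x, y, hxy, hfin⟩ := hP.proper
  have hpos : ∀ n, ENNReal.ofReal (T.prob n) ≠ 0 := fun n =>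
    (ENNReal.ofReal_pos.2 (T.prob_pos n)).ne'
  obtain ⟨h1, h2⟩ := ENNReal.add_lt_top.1 hfin
  refine ⟨x, y, hxy, fun h => ?_, fun n m hm h => ?_⟩
  · rw [h, ENNReal.mul_top (hpos _)] at h1
    exact lt_irrefl _ h1
  · have h3 := ENNReal.sum_lt_top.1 (ENNReal.sum_lt_top.1 h2 n (Finset.mem_univ n)) m hm
    rw [h, ENNReal.mul_top (hpos _)] at h3
    exact lt_irrefl _ h3

variable [∀ n, NormedSpace ℝ (E n)] [∀ n, NormedSpace ℝ (Y n)]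

theorem PenaltyCondition.psi_zero (hpen : P.PenaltyCondition) {n m : N} (hm : m ∈ T.children n) :
    P.ψ n m 0 = 0 := ((hpen.penalty n m hm).eq_zero_iff 0).2 rfl

theorem PenaltyCondition.psi_sub_le (hpen : P.PenaltyCondition) {n m : N}
    (hm : m ∈ T.children n) {a x : E n} (ha : a ∈ P.X n) (hx : x ∈ P.X n) :
    P.ψ n m (a - x) ≤ ‖a - x‖ := by
  have h := (hpen.lipschitz n m hm).dist_le_mul (a - x) (Set.sub_mem_sub ha hx) 0
    (by simpa using Set.sub_mem_sub ha ha)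
  rw [hpen.psi_zero hm, Real.dist_eq, sub_zero, dist_zero_right, NNReal.coe_one, one_mul] at h
  exact (le_abs_self _).trans h

theorem PenaltyCondition.continuousOn_psi_sub (hpen : P.PenaltyCondition) {n m : N}
    (hm : m ∈ T.children n) {a : E n} (ha : a ∈ P.X n) :
    ContinuousOn (fun x => P.ψ n m (a - x)) (P.X n) :=
  (hpen.lipschitz n m hm).continuousOn.comp (by fun_prop) fun _ hx => Set.sub_mem_sub ha hx

theorem PenaltyCondition.continuousOn_cut (hpen : P.PenaltyCondition) {n m : N}
    (hm : m ∈ T.children n) {a : E n} (ha : a ∈ P.X n) (l : StrongDual ℝ (E n)) (ρ v : ℝ) :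
    ContinuousOn (P.cut n m a l ρ v) (P.X n) := by
  have h1 := hpen.continuousOn_psi_sub hm ha
  have h2 : ContinuousOn (fun x => l (a - x)) (P.X n) := by fun_prop
  unfold cut
  fun_prop

/-- Bounds the slope of the upper model by that of the cuts; adding the two slopes produces the
factor 2 in `2 * P.L n`. -/
theorem PenaltyCondition.sigma_le (hpen : P.PenaltyCondition) {n m : N}
    (hm : m ∈ T.children n) : P.σ m ≤ P.lLam m + P.lRho m := by
  have hr := (T.mem_children.1 hm).1
  rcases hpen.bounds with ⟨-, h⟩ | h
  · linarith [(h n m hm).2.1, hpen.lRho_nonneg m hr]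
  · linarith [h m hr, hpen.lLam_nonneg m hr]

theorem PenaltyCondition.L_pos (hpen : P.PenaltyCondition) {n : N}
    (hn : (T.children n).Nonempty) : 0 < P.L n :=
  Finset.sum_pos (fun m hm => mul_pos (T.trans_pos n m)
    ((hpen.σ_pos m (T.mem_children.1 hm).1).trans_le (hpen.sigma_le hm))) hn

/-- The linear term is controlled by the dual norm, the other by the Lipschitz bound and `ψ 0 = 0`.
Both states must lie in `P.X n`, as `ψ` is Lipschitz only on differences of such states. -/
theorem PenaltyCondition.le_cut (hpen : P.PenaltyCondition) {n m : N} (hm : m ∈ T.children n)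
    {a x : E n} (ha : a ∈ P.X n) (hx : x ∈ P.X n) {u : StrongDual ℝ (E n) × ℝ}
    (hu : u ∈ P.dualSet n m) (v : ℝ) :
    v - (P.lLam m + P.lRho m) * ‖x - a‖ ≤ P.cut n m a u.1 u.2 v x := by
  obtain ⟨h1, h2, h3⟩ := hu
  have h4 : u.1 (a - x) ≤ P.lLam m * ‖a - x‖ :=
    (le_abs_self _).trans (u.1.le_of_opNorm_le h1 _)
  have h5 : u.2 * P.ψ n m (a - x) ≤ P.lRho m * ‖a - x‖ :=
    mul_le_mul h3 (hpen.psi_sub_le hm ha hx) ((hpen.penalty n m hm).nonneg _) (h2.trans h3)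
  rw [norm_sub_rev x a]
  unfold cut
  linarith

/-- The finite part of the objective of a nodal problem, without penalty, is convex. -/
theorem IsConvex.convexOn_toReal (h : P.IsConvex) {n m : N} (hm : m ∈ T.children n)
    {Θ : E m → ℝ} (hΘ : ConvexOn ℝ univ Θ) :
    ConvexOn ℝ {w | w ∈ P.feasible n m ∧ P.f n m w.2.2 w.2.1 w.1 ≠ ⊤}
      (fun w => (P.f n m w.2.2 w.2.1 w.1).toReal + Θ w.1) := by
  obtain ⟨hF, hf⟩ := h.convex_f n m hm
  have hlt : ∀ (s : ℝ) (c : ℝ≥0∞), c ≠ ⊤ → ENNReal.ofReal s * c ≠ ⊤ := fun s c hc =>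
    ENNReal.mul_ne_top ENNReal.ofReal_ne_top hc
  refine ⟨fun v hv w hw s t hs ht hst => ⟨hF hv.1 hw.1 hs ht hst, ?_⟩,
    fun v hv w hw s t hs ht hst => ?_⟩
  · exact ne_top_of_le_ne_top (ENNReal.add_ne_top.2 ⟨hlt s _ hv.2, hlt t _ hw.2⟩)
      (hf v hv.1 w hw.1 s t hs ht hst)
  · have h1 := ENNReal.toReal_mono (ENNReal.add_ne_top.2 ⟨hlt s _ hv.2, hlt t _ hw.2⟩)
      (hf v hv.1 w hw.1 s t hs ht hst)
    rw [ENNReal.toReal_add (hlt s _ hv.2) (hlt t _ hw.2), ENNReal.toReal_mul, ENNReal.toReal_mul,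
      ENNReal.toReal_ofReal hs, ENNReal.toReal_ofReal ht] at h1
    have h2 := hΘ.2 (mem_univ v.1) (mem_univ w.1) hs ht hst
    simp only [smul_eq_mul, Prod.fst_add, Prod.smul_fst] at h1 h2 ⊢
    linarith

/-- No gap between the penalized nodal problem and its (max-min) dual. -/
theorem PenaltyCondition.exists_dual (hpen : P.PenaltyCondition) {n m : N}
    (hm : m ∈ T.children n) (a : E n) {Θ : E m → ℝ}
    (hΘ : P.IsConvex → (∀ n, ∀ m ∈ T.children n, P.lRho m = 0) → ConvexOn ℝ univ Θ) {v : ℝ}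
    (hv : ∀ w ∈ P.feasible n m, (v : EReal) ≤ P.forwardObj n m a Θ w) :
    ∃ u ∈ P.dualSet n m, ∀ w ∈ P.feasible n m, (v : EReal) ≤ P.backwardObj n m a Θ u w := by
  have hr := (T.mem_children.1 hm).1
  have hσ := (hpen.σ_pos m hr).le
  rcases hpen.bounds with ⟨hconv, hb⟩ | hb
  -- Separation is applied on the set of finite cost; at the remaining points the inequality is
  -- trivial.
  · have hg := hconv.convexOn_toReal hm (hΘ hconv fun n m hm => (hb n m hm).2.2)
    obtain ⟨hψ, hl, hρ⟩ := hb n m hm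
    obtain ⟨l, hlσ, hlv⟩ := exists_dual_of_norm_penalty hg
      ((LinearMap.snd ℝ (Y m) (E n)).comp (LinearMap.snd ℝ (E m) (Y m × E n))) a hσ (v₀ := v) (by
        rintro w ⟨hw, hfw⟩
        have h1 := hv w hw
        rw [forwardObj, ← EReal.coe_ennreal_toReal hfw, ← EReal.coe_add, EReal.coe_le_coe_iff,
          hψ] at h1
        simp only [LinearMap.comp_apply, LinearMap.snd_apply]
        linarith)
    refine ⟨(l, 0), ⟨hlσ.trans hl, le_rfl, hρ.ge⟩, fun w hw => ?_⟩
    by_cases hfw : P.f n m w.2.2 w.2.1 w.1 = ⊤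
    · rw [backwardObj, hfw, EReal.coe_ennreal_top, EReal.top_add_coe]
      exact le_top
    · have h1 := hlv w ⟨hw, hfw⟩
      rw [backwardObj, ← EReal.coe_ennreal_toReal hfw, ← EReal.coe_add, EReal.coe_le_coe_iff]
      simp only [LinearMap.comp_apply, LinearMap.snd_apply] at h1
      linarith
  -- Here `ρ = σ` is admissible, and `(0, σ)` makes the backward objective equal to the forward one.
  · refine ⟨(0, P.σ m), ⟨by simpa using hpen.lLam_nonneg m hr, hσ, hb m hr⟩, fun w hw => ?_⟩
    simpa [forwardObj, backwardObj] using hv w hw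

end Problem

variable [∀ n, NormedSpace ℝ (E n)] [∀ n, NormedSpace ℝ (Y n)]

/-! ### Invariants of an execution -/

namespace IsExecution

variable {P : Problem T E Y} {O : P.Oracles} {ε : ℝ} {S : Iterates T E Y} {i : ℕ}

theorem root_eq (h : IsExecution P O ε S i) {j : ℕ} (hj : j ≤ i) :
    (S.x (j + 1) T.root, S.y (j + 1) T.root) = O.root (S.underQ j T.root) := by
  cases j with
  | zero => rw [h.root_init, funext (h.under_zero T.root)]
  | succ k => exact h.root_succ k hj

theorem lower_eq (h : IsExecution P O ε S i) {j : ℕ} (hj : j ≤ i) :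
    S.lower j = (P.fRoot (S.y (j + 1) T.root) (S.x (j + 1) T.root) : EReal) +
      ((S.underQ j T.root (S.x (j + 1) T.root) : ℝ) : EReal) := by
  cases j with
  | zero => rw [h.lower_zero, h.under_zero, EReal.coe_zero, add_zero]
  | succ k => exact h.lower_succ k hj

theorem upper_le_candidate (h : IsExecution P O ε S i) {j : ℕ} (hj : j < i) :
    S.upper (j + 1) ≤ S.candidate P (j + 1) := by
  by_cases hc : S.candidate P (j + 1) < S.upper j
  · exact (h.upper_update j hj hc).1.le
  · rw [(h.upper_keep j hj hc).1]
    exact not_lt.1 hc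

theorem under_le_succ (h : IsExecution P O ε S i) {j : ℕ} (hj : j < i) (n : N) (x : E n) :
    S.underQ j n x ≤ S.underQ (j + 1) n x := by
  rw [h.under_succ j hj]
  exact le_max_left _ _

theorem under_mono (h : IsExecution P O ε S i) {j k : ℕ} (hjk : j ≤ k) (hk : k ≤ i) (n : N)
    (x : E n) : S.underQ j n x ≤ S.underQ k n x := by
  induction k, hjk using Nat.le_induction with
  | base => exact le_rfl
  | succ k _ ih => exact (ih (by omega)).trans (h.under_le_succ (by omega) n x)

theorem over_succ_le (h : IsExecution P O ε S i) {j : ℕ} (hj : j < i) {n : N}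
    (hn : (T.children n).Nonempty) (x : E n) :
    S.overQ (j + 1) n x ≤ min (S.overQ j n x) (S.upperModel P (j + 1) n x) := by
  by_cases hc : P.IsConvex
  · rw [h.over_succ_convex hc j hj n hn]
    exact convMin_le_min _ _ _
  · rw [h.over_succ_nonconvex hc j hj n hn]

theorem over_succ_le_over (h : IsExecution P O ε S i) {j : ℕ} (hj : j < i) (n : N) (x : E n) :
    S.overQ (j + 1) n x ≤ S.overQ j n x := by
  rcases (T.children n).eq_empty_or_nonempty with hn | hn
  · rw [h.over_leaf _ hj n hn, h.over_leaf _ hj.le n hn]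
  · exact (h.over_succ_le hj hn x).trans (min_le_left _ _)

theorem over_anti (h : IsExecution P O ε S i) {j k : ℕ} (hjk : j ≤ k) (hk : k ≤ i) (n : N)
    (x : E n) : S.overQ k n x ≤ S.overQ j n x := by
  induction k, hjk using Nat.le_induction with
  | base => exact le_rfl
  | succ k _ ih => exact (h.over_succ_le_over (by omega) n x).trans (ih (by omega))

theorem under_leaf (h : IsExecution P O ε S i) {j : ℕ} (hj : j ≤ i) {n : N}
    (hn : T.children n = ∅) (x : E n) : S.underQ j n x = 0 := by
  induction j with
  | zero => exact h.under_zero n x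
  | succ k ih => rw [h.under_succ k hj, ih (by omega), hn, Finset.sum_empty, max_self]

/-- The oracles are specified only for semicontinuous models and parent states in the state space,
whereas cuts are known to be continuous only when generated at such states. The two facts are
therefore proved in tandem: here down the tree for a fixed iteration, then over iterations in
`continuousOn_under`. -/
theorem x_mem_of_continuousOn (h : IsExecution P O ε S i) {j : ℕ} (hj : j < i)
    (hc : ∀ n, ContinuousOn (S.underQ j n) (P.X n)) (n : N) : S.x (j + 1) n ∈ P.X n := by
  induction hs : T.stage n generalizing n with
  | zero =>
    have hn : n = T.root := by
      by_contra hn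
      have := T.stage_parent n hn
      omega
    subst hn
    have h1 := O.root_spec _ (hc T.root).lowerSemicontinuousOn
    rw [← h.root_eq hj.le] at h1
    exact ⟨_, h1.1, rfl⟩
  | succ s ih =>
    have hn : n ≠ T.root := by
      rintro rfl
      have := T.stage_root
      omega
    have hm : n ∈ T.children (T.parent n) := T.mem_children.2 ⟨hn, rfl⟩
    have h1 := O.forward_spec _ n hm _
      (ih (T.parent n) (by have := T.stage_of_mem_children hm; omega)) _
      (hc n).lowerSemicontinuousOn
    rw [← h.forward j hj _ n hm] at h1
    exact ⟨_, h1.1.1, rfl⟩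

theorem continuousOn_under (h : IsExecution P O ε S i) (hpen : P.PenaltyCondition) {j : ℕ}
    (hj : j ≤ i) (n : N) : ContinuousOn (S.underQ j n) (P.X n) := by
  induction j generalizing n with
  | zero =>
    rw [show S.underQ 0 n = fun _ => 0 from funext (h.under_zero n)]
    exact continuousOn_const
  | succ k ih =>
    have hx := h.x_mem_of_continuousOn hj fun n => ih (by omega) n
    rw [funext (h.under_succ k hj n)]
    refine ContinuousOn.sup (ih (by omega) n) (continuousOn_finsetSum _ fun m hm => ?_)
    exact continuousOn_const.mul (hpen.continuousOn_cut hm (hx n) _ _ _)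

theorem x_mem (h : IsExecution P O ε S i) (hpen : P.PenaltyCondition) {j : ℕ} (hj : j < i)
    (n : N) : S.x (j + 1) n ∈ P.X n :=
  h.x_mem_of_continuousOn hj (h.continuousOn_under hpen hj.le) n

theorem isRootSol (h : IsExecution P O ε S i) (hpen : P.PenaltyCondition) {j : ℕ} (hj : j ≤ i) :
    P.IsRootSol (S.underQ j T.root) (S.x (j + 1) T.root, S.y (j + 1) T.root) := by
  rw [h.root_eq hj]
  exact O.root_spec _ (h.continuousOn_under hpen hj T.root).lowerSemicontinuousOn

theorem isForwardSol (h : IsExecution P O ε S i) (hpen : P.PenaltyCondition) {j : ℕ} (hj : j < i)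
    {n m : N} (hm : m ∈ T.children n) :
    P.IsForwardSol n m (S.x (j + 1) n) (S.underQ j m)
      (S.x (j + 1) m, S.y (j + 1) m, S.z (j + 1) n m) := by
  rw [h.forward j hj n m hm]
  exact O.forward_spec n m hm _ (h.x_mem hpen hj n) _
    (h.continuousOn_under hpen hj.le m).lowerSemicontinuousOn

theorem isBackwardSol (h : IsExecution P O ε S i) (hpen : P.PenaltyCondition) {j : ℕ}
    (hj : j < i) {n m : N} (hm : m ∈ T.children n) :
    P.IsBackwardSol n m (S.x (j + 1) n) (S.underQ (j + 1) m)
      (S.xHat (j + 1) m, S.yHat (j + 1) m, S.zHat (j + 1) n m, S.lam (j + 1) n m,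
        S.rho (j + 1) m) := by
  rw [h.backward j hj n m hm]
  exact O.backward_spec n m hm _ (h.x_mem hpen hj n) _
    (h.continuousOn_under hpen hj m).lowerSemicontinuousOn

/-- When every `lRho` is zero, the multipliers `ρ` vanish and all cuts are affine. This supplies the
convexity that `exists_dual` requires in its separation branch. -/
theorem convexOn_under (h : IsExecution P O ε S i) (hpen : P.PenaltyCondition)
    (hρ : ∀ n, ∀ m ∈ T.children n, P.lRho m = 0) {j : ℕ} (hj : j ≤ i) (n : N) :
    ConvexOn ℝ univ (S.underQ j n) := by
  induction j with
  | zero =>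
    rw [show S.underQ 0 n = fun _ => 0 from funext (h.under_zero n)]
    exact convexOn_const 0 convex_univ
  | succ k ih =>
    rw [funext (h.under_succ k hj n)]
    refine (ih (by omega)).sup ⟨convex_univ, fun x _ x' _ s t hs ht hst => ?_⟩
    simp only [smul_eq_mul, Finset.mul_sum, ← Finset.sum_add_distrib]
    refine Finset.sum_le_sum fun m hm => le_of_eq ?_
    have h1 := (h.isBackwardSol hpen hj hm).1.2
    rw [hρ n m hm] at h1
    have h2 : S.rho (k + 1) m = 0 := le_antisymm h1.2 h1.1
    simp only [Problem.cut, h2, map_sub, map_add, map_smul, smul_eq_mul]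
    obtain rfl : t = 1 - s := by linarith
    ring

/-! ### Finite optimal values and propagation of gaps -/

/-- The copy `z` need not equal the trial parent state, and the penalty is finite. Hence the fixed
point of finite total cost is feasible in every nodal problem and bounds its optimum. -/
theorem f_ne_top (h : IsExecution P O ε S i) (hP : P.MinCondition) (hpen : P.PenaltyCondition)
    {j : ℕ} (hj : j < i) {n m : N} (hm : m ∈ T.children n) :
    P.f n m (S.z (j + 1) n m) (S.y (j + 1) m) (S.x (j + 1) m) ≠ ⊤ := by
  obtain ⟨x, y, hxy, -, hf⟩ := hP.exists_finite
  intro htop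
  have h1 : P.forwardObj n m _ _ _ ≤ P.forwardObj n m _ _ (x m, y m, x n) :=
    (h.isForwardSol hpen hj hm).2 (⟨hxy m, ⟨_, hxy n, rfl⟩⟩ : (x m, y m, x n) ∈ P.feasible n m)
  unfold Problem.forwardObj at h1
  dsimp only at h1
  rw [htop, EReal.coe_ennreal_top, EReal.top_add_coe, ← EReal.coe_ennreal_toReal (hf n m hm),
    ← EReal.coe_add, top_le_iff] at h1
  exact EReal.coe_ne_top _ h1

theorem fRoot_ne_top (h : IsExecution P O ε S i) (hP : P.MinCondition)
    (hpen : P.PenaltyCondition) {j : ℕ} (hj : j ≤ i) :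
    P.fRoot (S.y (j + 1) T.root) (S.x (j + 1) T.root) ≠ ⊤ := by
  obtain ⟨x, y, hxy, hf, -⟩ := hP.exists_finite
  intro htop
  have h1 : P.rootObj _ _ ≤ P.rootObj _ (x T.root, y T.root) :=
    (h.isRootSol hpen hj).2 (hxy T.root)
  unfold Problem.rootObj at h1
  dsimp only at h1
  rw [htop, EReal.coe_ennreal_top, EReal.top_add_coe, ← EReal.coe_ennreal_toReal hf,
    ← EReal.coe_add, top_le_iff] at h1
  exact EReal.coe_ne_top _ h1

theorem vLow_eq_backwardObj (h : IsExecution P O ε S i) (hP : P.MinCondition)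
    (hpen : P.PenaltyCondition) {j : ℕ} (hj : j < i) {n m : N} (hm : m ∈ T.children n) :
    (S.vLow (j + 1) m : EReal) = P.backwardObj n m (S.x (j + 1) n) (S.underQ (j + 1) m)
      (S.lam (j + 1) n m, S.rho (j + 1) m)
      (S.xHat (j + 1) m, S.yHat (j + 1) m, S.zHat (j + 1) n m) := by
  obtain ⟨x, y, hxy, -, hf⟩ := hP.exists_finite
  have h1 : P.backwardObj n m _ _ _ _ ≤ P.backwardObj n m _ _ _ (x m, y m, x n) :=
    (h.isBackwardSol hpen hj hm).2.2.2
      (⟨hxy m, ⟨_, hxy n, rfl⟩⟩ : (x m, y m, x n) ∈ P.feasible n m)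
  have hfin : P.f n m (S.zHat (j + 1) n m) (S.yHat (j + 1) m) (S.xHat (j + 1) m) ≠ ⊤ := by
    intro htop
    unfold Problem.backwardObj at h1
    dsimp only at h1
    rw [htop, EReal.coe_ennreal_top, EReal.top_add_coe, ← EReal.coe_ennreal_toReal (hf n m hm),
      ← EReal.coe_add, top_le_iff] at h1
    exact EReal.coe_ne_top _ h1
  unfold Problem.backwardObj
  dsimp only
  rw [h.vLow_eq j hj n m hm, ← EReal.coe_ennreal_toReal hfin, ← EReal.coe_add]
  congr 1
  ring

/-- The value of the backward step problem is at least that of the forward step problem. -/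
theorem forwardObj_le_vLow (h : IsExecution P O ε S i) (hP : P.MinCondition)
    (hpen : P.PenaltyCondition) {j : ℕ} (hj : j < i) {n m : N} (hm : m ∈ T.children n) :
    P.forwardObj n m (S.x (j + 1) n) (S.underQ j m)
      (S.x (j + 1) m, S.y (j + 1) m, S.z (j + 1) n m) ≤ (S.vLow (j + 1) m : EReal) := by
  have hfwd := h.isForwardSol hpen hj hm
  obtain ⟨-, hmax, hfeas, -⟩ := h.isBackwardSol hpen hj hm
  obtain ⟨v, hv⟩ : ∃ v : ℝ, (v : EReal) = P.forwardObj n m (S.x (j + 1) n) (S.underQ j m)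
      (S.x (j + 1) m, S.y (j + 1) m, S.z (j + 1) n m) := by
    unfold Problem.forwardObj
    dsimp only
    rw [← EReal.coe_ennreal_toReal (h.f_ne_top hP hpen hj hm), ← EReal.coe_add]
    exact ⟨_, rfl⟩
  -- The forward problem used the older, smaller model `underQ j`, so its value `v` still bounds the
  -- problem with `underQ (j + 1)` from below; duality is applied to the latter.
  obtain ⟨u, hu, huv⟩ := hpen.exists_dual hm (S.x (j + 1) n) (Θ := S.underQ (j + 1) m) (v := v)
    (fun _ hρ => h.convexOn_under hpen hρ hj m) (fun w hw => by
      rw [hv]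
      refine (hfwd.2 hw : P.forwardObj n m _ _ _ ≤ P.forwardObj n m _ _ w).trans ?_
      unfold Problem.forwardObj
      refine add_le_add le_rfl (EReal.coe_le_coe_iff.2 ?_)
      linarith [h.under_le_succ hj m w.1])
  rw [← hv, h.vLow_eq_backwardObj hP hpen hj hm]
  exact (le_iInf₂ huv).trans ((hmax hu).trans (iInf₂_le _ hfeas))

/-- `vUp` is the forward value with `overQ (j + 1)` in place of `underQ j` at the same point. Since
`overQ` decreases, the exchange costs at most `γ`, and the forward value is at most `vLow`. -/
theorem vUp_le (h : IsExecution P O ε S i) (hP : P.MinCondition)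
    (hpen : P.PenaltyCondition) {j : ℕ} (hj : j < i) {n m : N} (hm : m ∈ T.children n) {γ : ℝ}
    (hγ : S.overQ j m (S.x (j + 1) m) ≤ ((S.underQ j m (S.x (j + 1) m) + γ : ℝ) : EReal)) :
    S.vUp (j + 1) m ≤ ((S.vLow (j + 1) m + γ : ℝ) : EReal) := by
  have h1 := h.forwardObj_le_vLow hP hpen hj hm
  rw [h.vUp_eq j hj n m hm]
  refine (add_le_add le_rfl ((h.over_succ_le_over hj m _).trans hγ)).trans ?_
  unfold Problem.forwardObj at h1
  dsimp only at h1
  rw [← EReal.coe_ennreal_toReal (h.f_ne_top hP hpen hj hm), ← EReal.coe_add,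
    EReal.coe_le_coe_iff] at h1
  rw [← EReal.coe_ennreal_toReal (h.f_ne_top hP hpen hj hm), ← EReal.coe_add, ← EReal.coe_add,
    EReal.coe_le_coe_iff]
  linarith

/-- If after the forward step the children of `n` have approximation gaps at most `γ`, then all
later gaps at `n` are controlled by the distance from the trial state. -/
theorem over_le_under_add (h : IsExecution P O ε S i) (hP : P.MinCondition)
    (hpen : P.PenaltyCondition) {j k : ℕ} (hjk : j < k) (hk : k ≤ i) {n : N}
    (hn : (T.children n).Nonempty) {γ : N → ℝ}
    (hγ : ∀ m ∈ T.children n,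
      S.overQ j m (S.x (j + 1) m) ≤ ((S.underQ j m (S.x (j + 1) m) + γ m : ℝ) : EReal))
    {x : E n} (hx : x ∈ P.X n) :
    S.overQ k n x ≤ ((S.underQ k n x + (∑ m ∈ T.children n, T.trans n m * γ m +
      2 * P.L n * ‖x - S.x (j + 1) n‖) : ℝ) : EReal) := by
  have hj : j < i := by omega
  -- Both models are estimated through iteration `j + 1` alone; monotonicity carries the estimates
  -- to `k`.
  have h1 : S.overQ k n x ≤ S.upperModel P (j + 1) n x :=
    (h.over_anti hjk hk n x).trans ((h.over_succ_le hj hn x).trans (min_le_right _ _))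
  have h2 : S.upperModel P (j + 1) n x ≤ ((∑ m ∈ T.children n, T.trans n m *
      (S.vLow (j + 1) m + γ m + (P.lLam m + P.lRho m) * ‖x - S.x (j + 1) n‖) : ℝ) : EReal) := by
    rw [Iterates.upperModel, ereal_coe_sum]
    refine Finset.sum_le_sum fun m hm => ?_
    rw [EReal.coe_mul (T.trans n m)]
    refine mul_le_mul_of_nonneg_left ?_ (EReal.coe_nonneg.2 (T.trans_pos n m).le)
    rw [EReal.coe_add (S.vLow (j + 1) m + γ m)]
    exact add_le_add (h.vUp_le hP hpen hj hm (hγ m hm)) (EReal.coe_le_coe_iff.2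
      (mul_le_mul_of_nonneg_right (hpen.sigma_le hm) (norm_nonneg _)))
  have h3 : ∑ m ∈ T.children n, T.trans n m *
      (S.vLow (j + 1) m - (P.lLam m + P.lRho m) * ‖x - S.x (j + 1) n‖) ≤ S.underQ k n x := by
    refine le_trans ?_ (h.under_mono hjk hk n x)
    rw [h.under_succ j hj]
    refine le_trans (Finset.sum_le_sum fun m hm => ?_) (le_max_right _ _)
    exact mul_le_mul_of_nonneg_left
      (hpen.le_cut hm (h.x_mem hpen hj n) hx (h.isBackwardSol hpen hj hm).1 _)
      (T.trans_pos n m).le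
  refine h1.trans (h2.trans (EReal.coe_le_coe_iff.2 ?_))
  have h4 : ∑ m ∈ T.children n, T.trans n m *
      (S.vLow (j + 1) m + γ m + (P.lLam m + P.lRho m) * ‖x - S.x (j + 1) n‖) =
      ∑ m ∈ T.children n, T.trans n m *
        (S.vLow (j + 1) m - (P.lLam m + P.lRho m) * ‖x - S.x (j + 1) n‖) +
      (∑ m ∈ T.children n, T.trans n m * γ m + 2 * P.L n * ‖x - S.x (j + 1) n‖) := by
    rw [Problem.L, Finset.mul_sum, Finset.sum_mul, ← Finset.sum_add_distrib,
      ← Finset.sum_add_distrib]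
    exact Finset.sum_congr rfl fun m _ => by ring
  linarith

/-- `upper j` is at most the candidate at the very root solution that defines `lower j`, so the
finite root cost cancels from the loop test. For `j = 0` the upper model is `⊤`, which needs a
non-leaf root. -/
theorem root_gap (h : IsExecution P O ε S i) (hP : P.MinCondition)
    (hpen : P.PenaltyCondition) (hr : (T.children T.root).Nonempty) {j : ℕ} (hj : j < i) :
    ((S.underQ j T.root (S.x (j + 1) T.root) + ε : ℝ) : EReal) <
      S.overQ j T.root (S.x (j + 1) T.root) := by
  cases j with
  | zero =>
    rw [h.over_zero _ hr]
    exact EReal.coe_lt_top _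
  | succ k =>
    have h1 := EReal.add_lt_of_lt_sub (h.continues (k + 1) hj)
    have h2 := h1.trans_le (h.upper_le_candidate (by omega))
    rw [h.lower_eq hj.le, Iterates.candidate,
      ← EReal.coe_ennreal_toReal (h.fRoot_ne_top hP hpen hj.le)] at h2
    by_contra! hle
    refine (h2.trans_le (add_le_add le_rfl hle)).ne ?_
    simp only [← EReal.coe_add]
    congr 1
    ring

end IsExecution

end NestedDecomp

/-! ### Tolerances and the deepest excessive gap -/

namespace NestedDecomp

variable {N : Type*} [Fintype N] [DecidableEq N] {T : ScenarioTree N}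

/-- Distributing a total tolerance over the nodes: `γ` vanishes at leaves, and at a non-leaf node it
exceeds the mean of its values at the children by `δ`. -/
theorem ScenarioTree.exists_tolerances (T : ScenarioTree N) (δ : N → ℝ) :
    ∃ γ : N → ℝ, (∀ n, T.children n = ∅ → γ n = 0) ∧
      (∀ n, (T.children n).Nonempty → γ n = δ n + ∑ m ∈ T.children n, T.trans n m * γ m) ∧
      γ T.root = ∑ n ∈ T.nonLeaves, T.prob n * δ n := by
  -- Multiplied by `p_n`, the recursion for `γ` becomes that of a plain subtree sum.
  let b : N → ℝ := fun n => if (T.children n).Nonempty then T.prob n * δ n else 0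
  refine ⟨fun n => T.subtreeSum b n / T.prob n, fun n hn => ?_, fun n hn => ?_, ?_⟩
  · simp [T.subtreeSum_eq b n, b, hn]
  · have hp := (T.prob_pos n).ne'
    have h1 : ∀ m, T.trans n m * (T.subtreeSum b m / T.prob m) =
        T.subtreeSum b m / T.prob n := by
      intro m
      have := (T.prob_pos m).ne'
      rw [trans]
      field_simp
    simp only [h1]
    rw [← Finset.sum_div, T.subtreeSum_eq b n, add_div]
    congr 1
    simp only [b, if_pos hn]
    field_simp
  · dsimp only
    rw [T.prob_root, div_one, subtreeSum_root, nonLeaves, Finset.sum_filter]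

variable {E Y : N → Type*}
  [∀ n, NormedAddCommGroup (E n)] [∀ n, NormedAddCommGroup (Y n)]
  [∀ n, NormedSpace ℝ (E n)] [∀ n, NormedSpace ℝ (Y n)]
  {P : Problem T E Y} {O : P.Oracles} {ε : ℝ} {S : Iterates T E Y} {i : ℕ}

/-- If the gap at the root exceeds `γ`, some non-leaf node has a gap larger than its `γ`, while the
gaps of its children are within theirs. -/
theorem IsExecution.exists_last_gap (h : IsExecution P O ε S i) {γ : N → ℝ}
    (hleaf : ∀ n, T.children n = ∅ → γ n = 0) {j : ℕ} (hj : j < i)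
    (hroot : ((S.underQ j T.root (S.x (j + 1) T.root) + γ T.root : ℝ) : EReal) <
      S.overQ j T.root (S.x (j + 1) T.root)) :
    ∃ n ∈ T.nonLeaves,
      ((S.underQ j n (S.x (j + 1) n) + γ n : ℝ) : EReal) < S.overQ j n (S.x (j + 1) n) ∧
      ∀ m ∈ T.children n,
        S.overQ j m (S.x (j + 1) m) ≤ ((S.underQ j m (S.x (j + 1) m) + γ m : ℝ) : EReal) := by
  classical
  -- A violating node of largest stage has no violating child. It is not a leaf, where both models
  -- and `γ` are zero.
  obtain ⟨n, hn, hmax⟩ := Finset.exists_max_image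
    ({n | ((S.underQ j n (S.x (j + 1) n) + γ n : ℝ) : EReal) < S.overQ j n (S.x (j + 1) n)} :
      Finset N) T.stage ⟨T.root, (Finset.mem_filter_univ _).2 hroot⟩
  rw [Finset.mem_filter_univ] at hn
  refine ⟨n, ?_, hn, fun m hm => ?_⟩
  · rw [ScenarioTree.nonLeaves, Finset.mem_filter_univ]
    by_contra hne
    rw [Finset.not_nonempty_iff_eq_empty] at hne
    rw [h.over_leaf j hj.le n hne, h.under_leaf hj.le hne, hleaf n hne, add_zero,
      EReal.coe_zero] at hn
    exact lt_irrefl _ hn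
  · by_contra! hlt
    have h1 := hmax m (by rw [Finset.mem_filter_univ]; exact hlt)
    have h2 := T.stage_of_mem_children hm
    omega

end NestedDecomp

/-! ### Counting the iterations -/

theorem mainTheorem7 {N : Type*} [Fintype N] [DecidableEq N]
    (T : NestedDecomp.ScenarioTree N) {E Y : N → Type*}
    [∀ n, NormedAddCommGroup (E n)] [∀ n, NormedAddCommGroup (Y n)]
    [∀ n, NormedSpace ℝ (E n)] [∀ n, NormedSpace ℝ (Y n)]
    [∀ n, FiniteDimensional ℝ (E n)] [∀ n, FiniteDimensional ℝ (Y n)]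
    (P : NestedDecomp.Problem T E Y) (hP : P.MinCondition) (hpen : P.PenaltyCondition)
    (O : P.Oracles)
    (ε : ℝ) (hε : 0 < ε)
    (δ : N → ℝ) (hδ : ∀ n ∈ T.nonLeaves, 0 < δ n)
    (hsum : ∑ n ∈ T.nonLeaves, T.prob n * δ n = ε)
    (K : N → ℕ) (c : ∀ n, Fin (K n) → E n) (D : ∀ n, Fin (K n) → ℝ)
    (hD : ∀ n k, 0 ≤ D n k)
    (hcover : ∀ n, P.X n ⊆ ⋃ k, Metric.closedBall (c n k) (D n k / 2))
    (S : NestedDecomp.Iterates T E Y) (i : ℕ)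
    (hterm : NestedDecomp.TerminatesAt P O ε S i) :
    (i : ℝ) ≤ ∑ n ∈ T.nonLeaves, ∑ k : Fin (K n),
      (1 + 2 * P.L n * D n k / δ n) ^ Module.finrank ℝ (E n) := by
  classical
  have h := hterm.1
  obtain ⟨γ, hleaf, hγ, hroot⟩ := T.exists_tolerances δ
  rw [hsum] at hroot
  -- At a leaf root `γ` would be zero, but it equals `ε`.
  have hr : (T.children T.root).Nonempty := by
    by_contra hne
    rw [Finset.not_nonempty_iff_eq_empty] at hne
    linarith [hleaf _ hne]
  have hexists : ∀ j : Fin i, ∃ n ∈ T.nonLeaves,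
      (((S.underQ j n (S.x (j + 1) n) + γ n : ℝ) : EReal) < S.overQ j n (S.x (j + 1) n) ∧
      ∀ m ∈ T.children n,
        S.overQ j m (S.x (j + 1) m) ≤ ((S.underQ j m (S.x (j + 1) m) + γ m : ℝ) : EReal)) ∧
      ∃ k : Fin (K n), S.x (j + 1) n ∈ Metric.closedBall (c n k) (D n k / 2) := by
    intro j
    obtain ⟨n, hn, hgap⟩ := h.exists_last_gap hleaf j.2
      (by rw [hroot]; exact h.root_gap hP hpen hr j.2)
    exact ⟨n, hn, hgap, mem_iUnion.1 (hcover n (h.x_mem hpen j.2 n))⟩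
  choose node hnode hgap ball hball using hexists
  have hsep : ∀ j j' : Fin i, j < j' → node j = node j' →
      δ (node j) / (2 * P.L (node j)) ≤
        ‖S.x (j + 1) (node j) - S.x (j' + 1) (node j)‖ := by
    intro j j' hjj heq
    have hne : (T.children (node j)).Nonempty := by
      simpa [NestedDecomp.ScenarioTree.nonLeaves] using hnode j
    -- Index `j : Fin i` stands for iteration `j + 1`. The models with index `j'`, used in the
    -- forward step of iteration `j' + 1`, already contain its update because `j < j'`.
    have h1 := h.over_le_under_add hP hpen (Fin.lt_def.1 hjj) j'.2.le hne (hgap j).2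
      (h.x_mem hpen j'.2 (node j))
    have h2 := (hgap j').1
    rw [← heq] at h2
    have h3 := EReal.coe_lt_coe_iff.1 (h2.trans_le h1)
    have hL := hpen.L_pos hne
    rw [div_le_iff₀ (by positivity), norm_sub_rev]
    linarith [hγ _ hne]
  have hfiber : ∀ n ∈ T.nonLeaves, ∀ k : Fin (K n),
      ((Finset.univ.filter fun j : Fin i =>
        (⟨node j, ball j⟩ : Σ n, Fin (K n)) = ⟨n, k⟩).card : ℝ) ≤
      (1 + 2 * P.L n * D n k / δ n) ^ Module.finrank ℝ (E n) := by
    intro n hn k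
    have hL : 0 < P.L n := hpen.L_pos (by simpa [NestedDecomp.ScenarioTree.nonLeaves] using hn)
    have hδn := hδ n hn
    -- Packing with radius `R = D / 2` and separation `s = δ / (2 L)`.
    have hratio : 1 + 2 * P.L n * D n k / δ n =
        1 + 2 * (D n k / 2) / (δ n / (2 * P.L n)) := by
      field_simp
    rw [hratio]
    refine NestedDecomp.card_le_of_separated_of_mem_closedBall _
      (fun j : Fin i => S.x (j + 1) n) (c n k) (by linarith [hD n k]) (by positivity) ?_ ?_
    · intro j hj
      obtain ⟨rfl, hk⟩ := Sigma.mk.inj_iff.1 (Finset.mem_filter.1 hj).2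
      rw [← eq_of_heq hk]
      exact hball j
    · intro j hj j' hj' hjj
      have e1 := (Sigma.mk.inj_iff.1 (Finset.mem_filter.1 hj).2).1
      have e2 := (Sigma.mk.inj_iff.1 (Finset.mem_filter.1 hj').2).1
      rcases lt_or_gt_of_ne hjj with hlt | hlt
      · have := hsep j j' hlt (e1.trans e2.symm)
        rwa [e1] at this
      · have := hsep j' j hlt (e2.trans e1.symm)
        rwa [e2, norm_sub_rev] at this
  have hcount := Finset.card_eq_sum_card_fiberwise
    (f := fun j : Fin i => (⟨node j, ball j⟩ : Σ n, Fin (K n))) (s := Finset.univ)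
    (t := T.nonLeaves.sigma fun _ => Finset.univ)
    (fun j _ => Finset.mem_coe.2 (Finset.mem_sigma.2 ⟨hnode j, Finset.mem_univ _⟩))
  rw [Finset.card_fin, Finset.sum_sigma] at hcount
  calc (i : ℝ) = ∑ n ∈ T.nonLeaves, ∑ k : Fin (K n), ((Finset.univ.filter fun j : Fin i =>
        (⟨node j, ball j⟩ : Σ n, Fin (K n)) = ⟨n, k⟩).card : ℝ) := by exact_mod_cast hcount
    _ ≤ _ := Finset.sum_le_sum fun n hn => Finset.sum_le_sum fun k _ => hfiber n hn k
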